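/- Let $\Bbbk$ be a field and let $1\to N\to G\xrightarrow{\nu}\mathbb{Z}\to 1$ be a group extension with $G$ finitely presented. Choose $g\in G$ with $\nu(g)=1$, and regard $H_1(N,\Bbbk)$ as a module over the group ring $\Bbbk\mathbb{Z}=\Bbbk[t^{\pm1}]$ by letting $t$ act as the automorphism induced by the conjugation $n\mapsto gng^{-1}$ of $N$. Let $\nu_\Bbbk\in H^1(G,\Bbbk)=\operatorname{Hom}(G,\Bbbk)$ be the image of $\nu\in H^1(G,\mathbb{Z})=\operatorname{Hom}(G,\mathbb{Z})$ under the coefficient homomorphism $\mathbb{Z}\to\Bbbk$. Then $\nu_\Bbbk\cup\nu_\Bbbk=0$, so left multiplication by $\nu_\Bbbk$ turns the cohomology ring $H^*(G,\Bbbk)$ into a cochain complex $$H^0(G,\Bbbk)\xrightarrow{\nu_\Bbbk\cup}H^1(G,\Bbbk)\xrightarrow{\nu_\Bbbk\cup}H^2(G,\Bbbk)\to\cdots;$$ let $\beta_1(G,\nu_\Bbbk)$ be the dimension over $\Bbbk$ of its cohomology in degree $1$. Then the following are equivalent: 1. $H_1(N,\Bbbk)$ is finite-dimensional over $\Bbbk$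 and contains no $(t-1)$-primary Jordan block of size greater than $1$, that is, for no $i>1$ does the $\Bbbk\mathbb{Z}$-module $H_1(N,\Bbbk)$ have a direct summand isomorphic to $\Bbbk\mathbb{Z}/\big((t-1)^i\big)$. 2. $\beta_1(G,\nu_\Bbbk)=0$. -/

import Mathlib

open CategoryTheory

universe u

noncomputable section

/-! ### Jordan blocks of modules over the group ring of `ℤ` -/

namespace CyclicExtension

/-- The element `t - 1` of the group ring `kℤ = k[t, t⁻¹]`, where `t` is the generator `1 ∈ ℤ`
(the group `ℤ` is written multiplicatively). -/
def tSubOne (k : Type u) [Field k] : MonoidAlgebra k (Multiplicative ℤ) :=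
  MonoidAlgebra.of k (Multiplicative ℤ) (Multiplicative.ofAdd 1) - 1

/-- The module `M` over the commutative ring `R` contains an `f`-primary Jordan block of size `i`:
it has `R / (f ^ i)` as a direct summand. -/
def HasJordanBlock {R : Type*} [CommRing R] (f : R) (i : ℕ) (M : Type*) [AddCommGroup M]
    [Module R M] : Prop :=
  ∃ A B : Submodule R M, IsCompl A B ∧ Nonempty (A ≃ₗ[R] (R ⧸ Ideal.span {f ^ i}))

/-! ### The monodromy action on `H₁(N, k)` -/

/-- `H₁(N, k)`, group homology with trivial coefficients in `k`. -/
abbrev H1 (k N : Type u) [Field k] [Group N] : ModuleCat k :=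
  groupHomology (Rep.trivial k N k) 1

/-- The map induced on `H₁(N, k)` by an endomorphism of the group `N`. -/
def H1Map (k : Type u) {N : Type u} [Field k] [Group N] (f : N →* N) : H1 k N →ₗ[k] H1 k N :=
  (groupHomology.map (A := Rep.trivial k N k) (B := Rep.trivial k N k) f
    (𝟙 (Rep.trivial k N k)) 1).hom

theorem H1Map_id (k : Type u) {N : Type u} [Field k] [Group N] :
    H1Map k (MonoidHom.id N) = LinearMap.id := by
  unfold H1Map
  erw [groupHomology.map_id]
  rfl

theorem H1Map_comp (k : Type u) {N : Type u} [Field k] [Group N] (f g : N →* N) :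
    H1Map k (g.comp f) = H1Map k g ∘ₗ H1Map k f := by
  have h := groupHomology.map_comp (A := Rep.trivial k N k) (B := Rep.trivial k N k)
    (C := Rep.trivial k N k) f g (𝟙 (Rep.trivial k N k)) (𝟙 (Rep.trivial k N k)) 1
  exact congrArg ModuleCat.Hom.hom h

variable {k N G : Type u} [Field k] [Group N] [Group G]

/-- The action of `G` on `H₁(N, k)` induced by conjugation on the normal subgroup `N`. -/
def conjRep (k : Type u) [Field k] (S : GroupExtension N G (Multiplicative ℤ)) :
    Representation k G (H1 k N) where
  toFun g := H1Map k (S.conjAct g).toMonoidHom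
  map_one' := by
    rw [map_one]
    exact H1Map_id k
  map_mul' g h := by
    rw [map_mul]
    exact H1Map_comp k (S.conjAct h).toMonoidHom (S.conjAct g).toMonoidHom

/-- The action of `ℤ` on `H₁(N, k)` in which the generator `1 ∈ ℤ` acts by `(ι_g)_*`, where
`ι_g` is conjugation by `g`. For every `g` that maps to `1 ∈ ℤ`, this is the monodromy action of
the extension. -/
def monodromy (k : Type u) [Field k] (S : GroupExtension N G (Multiplicative ℤ)) (g : G) :
    Representation k (Multiplicative ℤ) (H1 k N) :=
  (conjRep k S).comp (zpowersHom G g)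

/-! ### The Aomoto complex of a group -/

/-- `Hⁿ(G, k)`, group cohomology with trivial coefficients in `k`. -/
abbrev Hcoh (k G : Type u) [Field k] [Group G] (n : ℕ) : ModuleCat k :=
  groupCohomology (Rep.trivial k G k) n

/-- The cup product `b ∪ f` of a `1`-cochain `b` with an `n`-cochain `f`:
`(b ∪ f)(g₀, …, gₙ) = b(g₀) f(g₁, …, gₙ)`. -/
def cupCochain (b : G → k) (n : ℕ) : ((Fin n → G) → k) →ₗ[k] ((Fin (n + 1) → G) → k) where
  toFun f g := b (g 0) * f (fun i => g i.succ)
  map_add' f f' := by ext g; simp [mul_add]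
  map_smul' r f := by ext g; simp; ring


theorem d_trivial_apply (n : ℕ) (f : (Fin n → G) → k) (g : Fin (n + 1) → G) :
    (inhomogeneousCochains.d (Rep.trivial k G k) n).hom f g =
      f (fun i => g i.succ) +
        ∑ j : Fin (n + 1), (-1 : k) ^ ((j : ℕ) + 1) * f (Fin.contractNth j (· * ·) g) :=
  rfl

/-- The Leibniz rule for `b ∪ f`. -/
theorem d_cupCochain (b : G → k) (n : ℕ) (f : (Fin n → G) → k) (g : Fin (n + 2) → G) :
    (inhomogeneousCochains.d (Rep.trivial k G k) (n + 1)).hom (cupCochain b n f) g =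
      (b (g 1) - b (g 0 * g 1) + b (g 0)) * f (fun i => g i.succ.succ) -
        b (g 0) * (inhomogeneousCochains.d (Rep.trivial k G k) n).hom f (fun i => g i.succ) := by
  have ht : ∀ i : Fin (n + 1), (fun j : Fin n => Fin.contractNth i.succ (· * ·) g j.succ) =
      Fin.contractNth i (· * ·) (fun j => g j.succ) := by
    intro i
    ext j
    simp only [Fin.contractNth, Fin.val_succ, add_lt_add_iff_right, add_left_inj]
    rfl
  have h0 : (fun j : Fin n => Fin.contractNth 0 (· * ·) g j.succ) =
      fun j => g j.succ.succ := by
    ext j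
    simp [Fin.contractNth]
  have h00 : Fin.contractNth 0 (· * ·) g 0 = g 0 * g 1 := by
    simp [Fin.contractNth]
  have h0s : ∀ i : Fin (n + 1), Fin.contractNth i.succ (· * ·) g 0 = g 0 := by
    intro i
    simp [Fin.contractNth]
  rw [d_trivial_apply, d_trivial_apply, Fin.sum_univ_succ]
  simp only [cupCochain, LinearMap.coe_mk, AddHom.coe_mk, ht, h0, h00, h0s, Fin.val_zero,
    Fin.val_succ, mul_add, Finset.mul_sum, Fin.succ_zero_eq_one, pow_succ, pow_zero]
  have hs : ∀ (i : Fin (n + 1)) (y : k), (-1 : k) ^ (i : ℕ) * -1 * -1 * (b (g 0) * y) =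
      -(b (g 0) * ((-1 : k) ^ (i : ℕ) * -1 * y)) := fun i y => by ring
  simp only [hs, Finset.sum_neg_distrib]
  ring

/-- Cup product with the class of a homomorphism `z : G → k` on cochains, anticommuting with the
differentials. -/
theorem d_cupCochain_hom (z : Additive G →+ k) (n : ℕ) :
    ModuleCat.ofHom (cupCochain (fun g => z (Additive.ofMul g)) n) ≫
        inhomogeneousCochains.d (Rep.trivial k G k) (n + 1) =
      -(inhomogeneousCochains.d (Rep.trivial k G k) n ≫
        ModuleCat.ofHom (cupCochain (fun g => z (Additive.ofMul g)) (n + 1))) := by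
  ext f g
  refine (d_cupCochain (fun g => z (Additive.ofMul g)) n f g).trans ?_
  rw [ofMul_mul, map_add]
  change _ = -(z (Additive.ofMul (g 0)) *
    (inhomogeneousCochains.d (Rep.trivial k G k) n).hom f (fun i => g i.succ))
  ring

/-- `b ∪ -` as a map between the terms of the complex of inhomogeneous cochains. -/
def cupX (b : G → k) (n : ℕ) :
    (groupCohomology.inhomogeneousCochains (Rep.trivial k G k)).X n ⟶
      (groupCohomology.inhomogeneousCochains (Rep.trivial k G k)).X (n + 1) :=
  ModuleCat.ofHom (cupCochain b n)

theorem cupX_d (z : Additive G →+ k) (n : ℕ) :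
    cupX (fun g => z (Additive.ofMul g)) n ≫
        (groupCohomology.inhomogeneousCochains (Rep.trivial k G k)).d (n + 1) (n + 2) =
      -((groupCohomology.inhomogeneousCochains (Rep.trivial k G k)).d n (n + 1) ≫
        cupX (fun g => z (Additive.ofMul g)) (n + 1)) := by
  rw [groupCohomology.inhomogeneousCochains.d_def, groupCohomology.inhomogeneousCochains.d_def]
  exact d_cupCochain_hom z n

/-- The map on cocycles induced by `z ∪ -`. -/
def cupCocycles (z : Additive G →+ k) (n : ℕ) :
    groupCohomology.cocycles (Rep.trivial k G k) n ⟶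
      groupCohomology.cocycles (Rep.trivial k G k) (n + 1) :=
  (groupCohomology.inhomogeneousCochains (Rep.trivial k G k)).liftCycles
    (groupCohomology.iCocycles _ n ≫ cupX (fun g => z (Additive.ofMul g)) n) (n + 2)
    (by simp) (by
      rw [Category.assoc, cupX_d, Preadditive.comp_neg, HomologicalComplex.iCycles_d_assoc,
        Limits.zero_comp, neg_zero])

theorem toCocycles_cupCocycles (z : Additive G →+ k) (n : ℕ) :
    groupCohomology.toCocycles (Rep.trivial k G k) ((ComplexShape.up ℕ).prev n) n ≫
      cupCocycles z n ≫ groupCohomology.π (Rep.trivial k G k) (n + 1) = 0 := by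
  rw [← Category.assoc, cupCocycles, HomologicalComplex.comp_liftCycles]
  rcases n with _ | n
  · refine HomologicalComplex.liftCycles_homologyπ_eq_zero_of_boundary _ _ _ _ (i' := 0) 0 ?_
    rw [HomologicalComplex.toCycles_i_assoc, Limits.zero_comp,
      HomologicalComplex.shape _ _ _ (by simp), Limits.zero_comp]
  · have hp : (ComplexShape.up ℕ).prev (n + 1) = n := by simp
    rw! [hp]
    refine HomologicalComplex.liftCycles_homologyπ_eq_zero_of_boundary _ _ _ _ (i' := n + 1)
      (-cupX (fun g => z (Additive.ofMul g)) n) ?_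
    rw [HomologicalComplex.toCycles_i_assoc, Preadditive.neg_comp, cupX_d, neg_neg]

/-- Left multiplication `z ∪ - : Hⁿ(G, k) → Hⁿ⁺¹(G, k)` by a class `z ∈ H¹(G, k) = Hom(G, k)` in
the cohomology ring of `G`. -/
def cup (z : Additive G →+ k) (n : ℕ) : Hcoh k G n ⟶ Hcoh k G (n + 1) :=
  ((groupCohomology.inhomogeneousCochains (Rep.trivial k G k)).homologyIsCokernel
    _ n rfl).desc (Limits.CokernelCofork.ofπ
      (cupCocycles z n ≫ groupCohomology.π (Rep.trivial k G k) (n + 1))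
      (toCocycles_cupCocycles z n))

theorem π_cup (z : Additive G →+ k) (n : ℕ) :
    groupCohomology.π (Rep.trivial k G k) n ≫ cup z n =
      cupCocycles z n ≫ groupCohomology.π (Rep.trivial k G k) (n + 1) :=
  ((groupCohomology.inhomogeneousCochains (Rep.trivial k G k)).homologyIsCokernel
    _ n rfl).fac _ Limits.WalkingParallelPair.one

/-- The class `ν_k ∈ H¹(G, k) = Hom(G, k)`: the image of `ν ∈ H¹(G, ℤ) = Hom(G, ℤ)` under the
coefficient homomorphism `ℤ → k`. -/
def nuClass (k : Type u) [Field k] (ν : G →* Multiplicative ℤ) : Additive G →+ k :=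
  (Int.castAddHom k).comp (MonoidHom.toAdditiveLeft ν)

theorem nuClass_apply (ν : G →* Multiplicative ℤ) (g : G) :
    nuClass k ν (Additive.ofMul g) = ((ν g).toAdd : k) := rfl

/-- The cup square of `ν_k` is a coboundary. -/
theorem cup_cup_nuClass (ν : G →* Multiplicative ℤ) (n : ℕ) :
    cup (nuClass k ν) n ≫ cup (nuClass k ν) (n + 1) = 0 := by
  set b : G → k := fun g => (((ν g).toAdd * ((ν g).toAdd - 1) / 2 : ℤ) : k) with hb
  have key : ∀ g h : G, b h - b (g * h) + b g = -(((ν g).toAdd : k) * ((ν h).toAdd : k)) := by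
    intro g h
    simp only [hb, map_mul, toAdd_mul]
    obtain ⟨x, hx⟩ := Int.even_mul_pred_self (ν g).toAdd
    obtain ⟨y, hy⟩ := Int.even_mul_pred_self (ν h).toAdd
    have hxy : ((ν g).toAdd + (ν h).toAdd) * ((ν g).toAdd + (ν h).toAdd - 1) =
        2 * (x + y + (ν g).toAdd * (ν h).toAdd) := by linear_combination hx + hy
    rw [hx, hy, hxy, ← two_mul, ← two_mul, Int.mul_ediv_cancel_left _ two_ne_zero,
      Int.mul_ediv_cancel_left _ two_ne_zero, Int.mul_ediv_cancel_left _ two_ne_zero]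
    push_cast
    ring
  have hX : groupCohomology.iCocycles (Rep.trivial k G k) n ≫
      cupX (fun g => nuClass k ν (Additive.ofMul g)) n ≫
        cupX (fun g => nuClass k ν (Additive.ofMul g)) (n + 1) =
      (groupCohomology.iCocycles (Rep.trivial k G k) n ≫ (-cupX b n)) ≫
        (groupCohomology.inhomogeneousCochains (Rep.trivial k G k)).d (n + 1) (n + 2) := by
    have h : cupX (fun g => nuClass k ν (Additive.ofMul g)) n ≫
        cupX (fun g => nuClass k ν (Additive.ofMul g)) (n + 1) =
        (-cupX b n) ≫
          (groupCohomology.inhomogeneousCochains (Rep.trivial k G k)).d (n + 1) (n + 2) -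
        (groupCohomology.inhomogeneousCochains (Rep.trivial k G k)).d n (n + 1) ≫
          cupX b (n + 1) := by
      rw [groupCohomology.inhomogeneousCochains.d_def,
        groupCohomology.inhomogeneousCochains.d_def]
      ext f g
      have hd := d_cupCochain b n f g
      rw [key] at hd
      change ((ν (g 0)).toAdd : k) * (((ν (g 1)).toAdd : k) * f (fun i => g i.succ.succ)) =
        (inhomogeneousCochains.d (Rep.trivial k G k) (n + 1)).hom (-cupCochain b n f) g -
          b (g 0) * (inhomogeneousCochains.d (Rep.trivial k G k) n).hom f (fun i => g i.succ)
      rw [map_neg]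
      change _ = -((inhomogeneousCochains.d (Rep.trivial k G k) (n + 1)).hom
        (cupCochain b n f) g) - _
      rw [hd]
      ring
    rw [h, Preadditive.comp_sub, HomologicalComplex.iCycles_d_assoc, Limits.zero_comp, sub_zero,
      Category.assoc]
  have hc : cupCocycles (nuClass k ν) n ≫ cupCocycles (nuClass k ν) (n + 1) ≫
      groupCohomology.π (Rep.trivial k G k) (n + 2) = 0 := by
    rw [← Category.assoc, cupCocycles, cupCocycles, HomologicalComplex.comp_liftCycles]
    refine HomologicalComplex.liftCycles_homologyπ_eq_zero_of_boundary _ _ _ _ (i' := n + 1)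
      (groupCohomology.iCocycles (Rep.trivial k G k) n ≫ (-cupX b n)) ?_
    rw [HomologicalComplex.liftCycles_i_assoc, Category.assoc, hX]
  have : Epi (groupCohomology.π (Rep.trivial k G k) n) :=
    inferInstanceAs (Epi (HomologicalComplex.homologyπ _ n))
  rw [← cancel_epi (groupCohomology.π (Rep.trivial k G k) n), ← Category.assoc, π_cup,
    Category.assoc, π_cup, hc, Limits.comp_zero]

/-- The Aomoto complex `H⁰(G, k) → H¹(G, k) → H²(G, k) → ⋯`, whose differentials are left
multiplication by `ν_k`. -/
def aomotoComplex (k : Type u) [Field k] (ν : G →* Multiplicative ℤ) :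
    CochainComplex (ModuleCat k) ℕ :=
  CochainComplex.of (fun n => Hcoh k G n) (fun n => cup (nuClass k ν) n)
    (fun n => cup_cup_nuClass ν n)

/-- The Aomoto–Betti number `β_q(G, ν_k)`, the dimension over `k` (as a cardinal) of the `q`-th
cohomology of the Aomoto complex. -/
def aomotoBetti (k : Type u) [Field k] (ν : G →* Multiplicative ℤ) (q : ℕ) : Cardinal.{u} :=
  Module.rank k ((aomotoComplex k ν).homology q)

end CyclicExtension

end

/-!
Let `M = H₁(N, k)`, let `T = t - 1` act on it, and write `R = k[t, t⁻¹]`. Both conditions of the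
theorem say that `T M = T² M`.

*Cohomology.* A class in `H¹(G, k)` is a homomorphism `f : G → k`, and `ν_k ∪ f = 0` means that
some `c : G → k` satisfies `c x + c y - c (x * y) = ν x * f y`. On `N`, where `ν` vanishes, such a
`c` is a homomorphism, that is, a functional `ψ` on `M`, and comparing `c (g * n)` with
`c (g * n * g⁻¹ * g)` gives `f = -ψ ∘ T` on `N`. Since `f` is invariant under conjugation, also
`ψ ∘ T² = 0`. Conversely, a functional `ψ` with `ψ ∘ T² = 0` extends from `N` to such a pair
`(f, c)` by means of the decomposition `x = n * g ^ ν x` of the elements of `G`. So `β₁ = 0` if and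
only if `ψ ∘ T² = 0` implies `ψ ∘ T = 0` for all functionals `ψ`
(`aomotoBetti_one_eq_zero_iff_forall_dual`), and by duality if and only if `T M = T² M`
(`forall_dual_comp_eq_zero_iff`).

*Algebra.* As `G` is finitely generated, `M` is finitely generated over `R`
(`finite_monodromy_asModule`), and `R` is a principal ideal domain in which `t - 1` is prime. If
`T M = T² M`, then no `R / (T ^ i)` with `i > 1` is a direct summand of `M`, and Nakayama's lemma
provides an `r ≡ 1 mod T` that kills `T M`, so that `M` is a finitely generated module over the
finite-dimensional algebra `R / (r T)`. If `M` is finite-dimensional, it is torsion, hence a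
direct sum of modules `R / (p ^ e)` with `p` irreducible. On such a module `T` is invertible if `p`
is not associated to `T`, and it is zero if `p` is associated to `T` and `e ≤ 1`; without Jordan
blocks of size greater than `1` there are no others, and `T M = T² M`
(`finite_and_not_hasJordanBlock_iff`).
-/

noncomputable section

namespace CyclicExtension

/-! ### The ring of Laurent polynomials -/

variable {k : Type u} [Field k]

theorem isPrincipalIdealRing_of_isLocalization {A : Type*} [CommRing A] [IsPrincipalIdealRing A]
    (W : Submonoid A) (B : Type*) [CommRing B] [Algebra A B] [IsLocalization W B] :
    IsPrincipalIdealRing B where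
  principal I := by
    obtain ⟨a, ha⟩ := IsPrincipalIdealRing.principal (I.comap (algebraMap A B))
    refine ⟨algebraMap A B a, ?_⟩
    rw [← IsLocalization.map_under W B I, Ideal.under, ha]
    simp [Ideal.submodule_span_eq, Ideal.map_span]

instance (k : Type*) [Field k] : IsPrincipalIdealRing (MonoidAlgebra k (Multiplicative ℤ)) :=
  have : IsPrincipalIdealRing (LaurentPolynomial k) :=
    isPrincipalIdealRing_of_isLocalization (Submonoid.powers (Polynomial.X : Polynomial k)) _
  .of_surjective (AddMonoidAlgebra.toMultiplicative k ℤ).toRingHom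
    (AddMonoidAlgebra.toMultiplicative k ℤ).surjective

instance (k : Type*) [Field k] : IsDomain (MonoidAlgebra k (Multiplicative ℤ)) where

/-- The augmentation `k[t, t⁻¹] → k`, `t ↦ 1`. -/
def augmentation (k : Type u) [Field k] : MonoidAlgebra k (Multiplicative ℤ) →ₐ[k] k :=
  MonoidAlgebra.lift k k (Multiplicative ℤ) 1

theorem augmentation_tSubOne : augmentation k (tSubOne k) = 0 := by
  simp [augmentation, tSubOne]

theorem tSubOne_dvd_of_sub_one (n : Multiplicative ℤ) :
    tSubOne k ∣ MonoidAlgebra.of k (Multiplicative ℤ) n - 1 := by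
  have hn : ∀ m : ℕ, tSubOne k ∣
      MonoidAlgebra.of k (Multiplicative ℤ) (Multiplicative.ofAdd (m : ℤ)) - 1 := by
    intro m
    have h := sub_dvd_pow_sub_pow
      (MonoidAlgebra.of k (Multiplicative ℤ) (Multiplicative.ofAdd (1 : ℤ))) 1 m
    rwa [← map_pow, one_pow, ← ofAdd_nsmul, nsmul_one] at h
  obtain ⟨m, hm⟩ := n.toAdd.eq_nat_or_neg
  obtain rfl | rfl : n = Multiplicative.ofAdd (m : ℤ) ∨ n = (Multiplicative.ofAdd (m : ℤ))⁻¹ := hm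
  · exact hn m
  · have h : MonoidAlgebra.of k (Multiplicative ℤ) (Multiplicative.ofAdd (m : ℤ))⁻¹ - 1 =
        -(MonoidAlgebra.of k (Multiplicative ℤ) (Multiplicative.ofAdd (m : ℤ))⁻¹ *
          (MonoidAlgebra.of k (Multiplicative ℤ) (Multiplicative.ofAdd (m : ℤ)) - 1)) := by
      rw [mul_sub, ← map_mul, inv_mul_cancel, map_one, mul_one, neg_sub]
    rw [h]
    exact ((hn m).mul_left _).neg_right

/-- The ideal generated by `t - 1` is the augmentation ideal. -/
theorem tSubOne_dvd_iff (x : MonoidAlgebra k (Multiplicative ℤ)) :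
    tSubOne k ∣ x ↔ augmentation k x = 0 := by
  constructor
  · rintro ⟨y, rfl⟩
    rw [map_mul, augmentation_tSubOne, zero_mul]
  · intro hx
    have h : tSubOne k ∣ x - algebraMap k _ (augmentation k x) := by
      clear hx
      induction x using MonoidAlgebra.induction_on with
      | of n => simpa [augmentation, MonoidAlgebra.one_def] using tSubOne_dvd_of_sub_one (k := k) n
      | add a b ha hb => simpa [add_sub_add_comm] using dvd_add ha hb
      | smul r a ha =>
        rw [Algebra.smul_def, map_mul, map_mul, AlgHom.commutes, Algebra.algebraMap_self,
          RingHom.id_apply, ← mul_sub]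
        exact ha.mul_left _
    simpa [hx] using h

theorem tSubOne_ne_zero : tSubOne k ≠ 0 := by
  intro h
  have := MonoidAlgebra.of_injective (R := k) (M := Multiplicative ℤ)
    ((sub_eq_zero.1 h).trans (map_one (MonoidAlgebra.of k (Multiplicative ℤ))).symm)
  exact absurd (congrArg Multiplicative.toAdd this) (by simp)

theorem prime_tSubOne : Prime (tSubOne k) := by
  refine ⟨tSubOne_ne_zero, fun h => ?_, fun a b h => ?_⟩
  · exact one_ne_zero (α := k) (by simpa using (tSubOne_dvd_iff 1).1 h.dvd)
  · simpa [tSubOne_dvd_iff] using h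

/-- The quotient of `k[t, t⁻¹]` by `b ≠ 0` is Artinian, as its nonzero primes are maximal, so
finite-dimensional by the Nullstellensatz. -/
theorem finite_quotient_span_singleton {b : MonoidAlgebra k (Multiplicative ℤ)} (hb : b ≠ 0) :
    Module.Finite k (MonoidAlgebra k (Multiplicative ℤ) ⧸ Ideal.span {b}) := by
  have : Ring.KrullDimLE 0 (MonoidAlgebra k (Multiplicative ℤ) ⧸ Ideal.span {b}) := by
    refine Ring.krullDimLE_zero_iff.2 fun I hI => ?_
    have hc : (I.comap (Ideal.Quotient.mk (Ideal.span {b}))).IsMaximal := by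
      refine Ideal.IsPrime.isMaximal inferInstance fun h0 => hb ?_
      rw [← Ideal.mem_bot, ← h0, Ideal.mem_comap,
        Ideal.Quotient.eq_zero_iff_mem.2 (Ideal.mem_span_singleton_self b)]
      exact I.zero_mem
    rw [← Ideal.map_comap_of_surjective _ Ideal.Quotient.mk_surjective I]
    exact (Ideal.map_eq_top_or_isMaximal_of_surjective _ Ideal.Quotient.mk_surjective
      hc).resolve_left (by
        rw [Ideal.map_comap_of_surjective _ Ideal.Quotient.mk_surjective I]; exact hI.ne_top)
  have : IsArtinianRing (MonoidAlgebra k (Multiplicative ℤ) ⧸ Ideal.span {b}) :=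
    isArtinianRing_iff_isNoetherianRing_krullDimLE_zero.2 ⟨inferInstance, this⟩
  have : Algebra.FiniteType k (MonoidAlgebra k (Multiplicative ℤ)) :=
    MonoidAlgebra.finiteType_of_fg
  exact Module.finite_of_isArtinianRing k _

theorem not_finite_groupRing :
    ¬ Module.Finite k (MonoidAlgebra k (Multiplicative ℤ)) := fun h => by
  have h' := (MonoidAlgebra.coeffLinearEquiv k : MonoidAlgebra k (Multiplicative ℤ) ≃ₗ[k] _)
  have : Module.Finite k (Multiplicative ℤ →₀ k) := .equiv h'
  have := (Module.finite_finsupp_self_iff (R := k) (ι := Multiplicative ℤ)).1 this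
  rcases this with h | h
  · exact not_subsingleton k h
  · exact not_finite (Multiplicative ℤ)

/-! ### Jordan blocks over a principal ideal domain -/

section PID

variable {R M : Type*} [CommRing R] [AddCommGroup M] [Module R M]

theorem hasJordanBlock_of_retract {f : R} {i : ℕ} (s : (R ⧸ Ideal.span {f ^ i}) →ₗ[R] M)
    (p : M →ₗ[R] (R ⧸ Ideal.span {f ^ i})) (h : p ∘ₗ s = LinearMap.id) :
    HasJordanBlock f i M := by
  have hps : ∀ x, p (s x) = x := fun x => congr($h x)
  have hc : IsCompl (LinearMap.range s) (LinearMap.ker (s.rangeRestrict ∘ₗ p)) :=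
    LinearMap.isCompl_of_proj fun ⟨_, x, hx⟩ => Subtype.ext (by simp [← hx, hps])
  exact ⟨_, _, hc, ⟨(LinearEquiv.ofInjective s
    (Function.LeftInverse.injective hps)).symm⟩⟩

/-- Multiplication by `f` and by `f ^ 2` have the same image in `M`, that is, `f M = f² M`. -/
def SmulImageStable (f : R) (M : Type*) [AddCommGroup M] [Module R M] : Prop :=
  ∀ m : M, ∃ m' : M, f • m = f ^ 2 • m'

theorem SmulImageStable.not_hasJordanBlock [IsDomain R] {f : R} (hf : Prime f)
    (h : SmulImageStable f M) {i : ℕ} (hi : 1 < i) : ¬ HasJordanBlock f i M := by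
  rintro ⟨A, B, hAB, ⟨e⟩⟩
  obtain ⟨m, hm⟩ := h (e.symm (Ideal.Quotient.mk _ 1))
  -- Project the equation to `A` and read it in `R / (f ^ i)`: it says `f² ∣ f - f² * r`.
  have h1 := congrArg (fun x => e (A.projectionOnto B hAB x)) hm
  obtain ⟨r, hr⟩ := Ideal.Quotient.mk_surjective (e (A.projectionOnto B hAB m))
  simp only [map_smul, Submodule.projectionOnto_apply_left, LinearEquiv.apply_symm_apply] at h1
  rw [← hr] at h1
  have h2 : f * 1 - f ^ 2 * r ∈ Ideal.span {f ^ i} := Ideal.Quotient.eq.1 h1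
  have h3 : f ^ 2 ∣ f * 1 - f ^ 2 * r :=
    (pow_dvd_pow f hi).trans (Ideal.mem_span_singleton.1 h2)
  have h4 : f * f ∣ f * 1 := by
    rw [← pow_two]
    exact (dvd_sub_left (dvd_mul_right _ _)).1 h3
  exact hf.not_isUnit (isUnit_of_dvd_one ((mul_dvd_mul_iff_left hf.ne_zero).1 h4))

/-- By Nakayama's lemma some `r` congruent to `1` modulo `f` kills `f M = f (f M)`, and then
`r * f` kills `M`. -/
theorem SmulImageStable.exists_annihilator [IsDomain R] {f : R} (hf : Prime f)
    [Module.Finite R M] [IsNoetherianRing R] (h : SmulImageStable f M) :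
    ∃ b : R, b ≠ 0 ∧ ∀ m : M, b • m = 0 := by
  obtain ⟨r, hr, hN⟩ := Submodule.exists_sub_one_mem_and_smul_eq_zero_of_fg_of_le_smul
    (Ideal.span {f}) (LinearMap.range (LinearMap.lsmul R M f)) (IsNoetherian.noetherian _) (by
      rintro _ ⟨m, rfl⟩
      obtain ⟨m', hm'⟩ := h m
      rw [LinearMap.lsmul_apply, hm', pow_two, mul_smul]
      exact Submodule.smul_mem_smul (Ideal.mem_span_singleton_self f) ⟨m', rfl⟩)
  refine ⟨r * f, mul_ne_zero ?_ hf.ne_zero, fun m => ?_⟩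
  · rintro rfl
    rw [zero_sub, neg_mem_iff, Ideal.mem_span_singleton] at hr
    exact hf.not_isUnit (isUnit_of_dvd_one hr)
  · rw [mul_smul]
    exact hN _ ⟨m, rfl⟩

theorem smulImageStable_of_not_hasJordanBlock [IsDomain R] [IsPrincipalIdealRing R] {f : R}
    (hf : Prime f) [Module.Finite R M] (hM : Module.IsTorsion R M)
    (h : ∀ i, 1 < i → ¬ HasJordanBlock f i M) : SmulImageStable f M := by
  classical
  obtain ⟨ι, _, p, hp, e, ⟨E⟩⟩ := Module.equiv_directSum_of_isTorsion hM
  have hcyc : ∀ i, SmulImageStable f (R ⧸ Ideal.span {p i ^ e i}) := by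
    intro i x
    obtain ⟨a, rfl⟩ := Ideal.Quotient.mk_surjective x
    by_cases hpf : p i ∣ f
    -- The summand is `f`-primary: it is killed by `f`, being a Jordan block of size at most `1`.
    · have hass : Associated (p i) f := (hp i).associated_of_dvd hf.irreducible hpf
      have hspan : Ideal.span {p i ^ e i} = Ideal.span {f ^ e i} :=
        Ideal.span_singleton_eq_span_singleton.2 (hass.pow_pow)
      have he : e i ≤ 1 := by
        by_contra! he
        refine h _ he (hasJordanBlock_of_retract
          (E.symm.toLinearMap ∘ₗ DirectSum.lof R ι (fun i => R ⧸ Ideal.span {p i ^ e i}) i ∘ₗ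
            (Submodule.quotEquivOfEq _ _ hspan.symm).toLinearMap)
          ((Submodule.quotEquivOfEq _ _ hspan).toLinearMap ∘ₗ
            DirectSum.component R ι (fun i => R ⧸ Ideal.span {p i ^ e i}) i ∘ₗ E.toLinearMap) ?_)
        refine LinearMap.ext fun y => ?_
        obtain ⟨y, rfl⟩ := Ideal.Quotient.mk_surjective y
        simp [DirectSum.component.lof_self]
        rfl
      refine ⟨0, ?_⟩
      rw [smul_zero]
      refine Ideal.Quotient.eq_zero_iff_mem.2 (?_ : f * a ∈ _)
      rw [hspan, Ideal.mem_span_singleton]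
      exact (pow_dvd_pow f he).trans (by simp)
    -- Otherwise `f` is invertible on the summand, with inverse `v`.
    · obtain ⟨u, v, huv⟩ : IsCoprime (p i ^ e i) f :=
        (((hp i).coprime_iff_not_dvd).2 hpf).pow_left
      refine ⟨Ideal.Quotient.mk _ (v * a), Ideal.Quotient.eq.2
        (?_ : f * a - f ^ 2 * (v * a) ∈ _)⟩
      rw [Ideal.mem_span_singleton]
      exact ⟨u * f * a, by linear_combination (-f * a) * huv⟩
  have hsum : ∀ x : DirectSum ι (fun i => R ⧸ Ideal.span {p i ^ e i}), ∃ y, f • x = f ^ 2 • y := by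
    intro x
    induction x using DirectSum.induction_on with
    | zero => exact ⟨0, by simp⟩
    | of i x =>
      obtain ⟨y, hy⟩ := hcyc i x
      exact ⟨DirectSum.lof R ι (fun i => R ⧸ Ideal.span {p i ^ e i}) i y, by
        change f • DirectSum.lof R ι (fun i => R ⧸ Ideal.span {p i ^ e i}) i x = _
        rw [← map_smul, hy, map_smul]⟩
    | add x y hx hy =>
      obtain ⟨x', hx'⟩ := hx
      obtain ⟨y', hy'⟩ := hy
      exact ⟨x' + y', by rw [smul_add, smul_add, hx', hy']⟩
  intro m
  obtain ⟨y, hy⟩ := hsum (E m)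
  exact ⟨E.symm y, E.injective (by simpa using hy)⟩

end PID

theorem finite_and_not_hasJordanBlock_iff (M : Type*) [AddCommGroup M] [Module k M]
    [Module (MonoidAlgebra k (Multiplicative ℤ)) M]
    [IsScalarTower k (MonoidAlgebra k (Multiplicative ℤ)) M]
    [Module.Finite (MonoidAlgebra k (Multiplicative ℤ)) M] :
    (Module.Finite k M ∧ ∀ i : ℕ, 1 < i → ¬ HasJordanBlock (tSubOne k) i M) ↔
      SmulImageStable (tSubOne k) M := by
  constructor
  · rintro ⟨hfin, hJ⟩
    refine smulImageStable_of_not_hasJordanBlock prime_tSubOne (fun m => ?_) hJ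
    -- If no `r ≠ 0` kills `m`, then the infinite-dimensional `k[t, t⁻¹]` embeds into `M` by
    -- `r ↦ r • m`.
    by_contra! hm
    refine not_finite_groupRing (k := k) (Module.Finite.of_injective
      ((LinearMap.toSpanSingleton (MonoidAlgebra k (Multiplicative ℤ)) M m).restrictScalars k) ?_)
    refine (injective_iff_map_eq_zero _).2 fun r hr => ?_
    by_contra hr0
    exact hm ⟨r, mem_nonZeroDivisors_of_ne_zero hr0⟩ hr
  · intro h
    refine ⟨?_, fun i hi => h.not_hasJordanBlock prime_tSubOne hi⟩
    obtain ⟨b, hb, hbM⟩ := h.exists_annihilator prime_tSubOne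
    have ht : Module.IsTorsionBySet (MonoidAlgebra k (Multiplicative ℤ)) M
        (Ideal.span {b} : Ideal (MonoidAlgebra k (Multiplicative ℤ))) :=
      (Module.isTorsionBySet_span_singleton_iff b).2 fun m => hbM m
    let := ht.module
    have := finite_quotient_span_singleton hb
    have : IsScalarTower k (MonoidAlgebra k (Multiplicative ℤ) ⧸ Ideal.span {b}) M :=
      ht.isScalarTower
    have : Module.Finite (MonoidAlgebra k (Multiplicative ℤ) ⧸ Ideal.span {b}) M :=
      Module.Finite.of_restrictScalars_finite (MonoidAlgebra k (Multiplicative ℤ)) _ _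
    exact Module.Finite.trans (MonoidAlgebra k (Multiplicative ℤ) ⧸ Ideal.span {b}) M

/-! ### Group homology in degree one -/

section Homology

variable {N : Type u} [Group N]

/-- The class in `H₁(N, k)` of a `1`-chain; with trivial coefficients, every `1`-chain is a
cycle. -/
def chainClass (k : Type u) [Field k] (N : Type u) [Group N] : (N →₀ k) →ₗ[k] H1 k N :=
  (groupHomology.H1π (Rep.trivial k N k)).hom ∘ₗ
    (groupHomology.cycles₁IsoOfIsTrivial (Rep.trivial k N k)).inv.hom

theorem chainClass_surjective : Function.Surjective (chainClass k N) := by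
  intro x
  induction x using groupHomology.H1_induction_on with
  | h x => exact ⟨x.1, rfl⟩

theorem chainClass_eq_zero_iff (x : N →₀ k) :
    chainClass k N x = 0 ↔ x ∈ groupHomology.boundaries₁ (Rep.trivial k N k) :=
  groupHomology.H1π_eq_zero_iff _

/-- The class in `H₁(N, k)` of an element of `N`, that is, its image under
`N → N^ab ⊗ k ≅ H₁(N, k)`. -/
def hurewicz (k : Type u) [Field k] {N : Type u} [Group N] (n : N) : H1 k N :=
  chainClass k N (Finsupp.single n 1)

theorem boundary_single (a b : N) (r : k) :
    (groupHomology.d₂₁ (Rep.trivial k N k)).hom (Finsupp.single (a, b) r) =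
      (Finsupp.single b r - Finsupp.single (a * b) r + Finsupp.single a r : N →₀ k) := by
  refine (groupHomology.d₂₁_single (A := Rep.trivial k N k) (a, b) r).trans ?_
  rfl

theorem hurewicz_mul (a b : N) : hurewicz k (a * b) = hurewicz k a + hurewicz k b := by
  rw [eq_comm, ← sub_eq_zero, hurewicz, hurewicz, hurewicz, ← map_add, ← map_sub,
    chainClass_eq_zero_iff]
  refine ⟨Finsupp.single (a, b) 1, (boundary_single a b 1).trans ?_⟩
  abel

theorem span_range_hurewicz :
    Submodule.span k (Set.range (hurewicz k : N → H1 k N)) = ⊤ := by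
  rw [← Finsupp.range_linearCombination]
  have h : Finsupp.linearCombination k (hurewicz k : N → H1 k N) = chainClass k N := by
    refine Finsupp.lhom_ext fun n r => ?_
    rw [Finsupp.linearCombination_single, hurewicz, ← map_smul, Finsupp.smul_single_one]
  rw [h, LinearMap.range_eq_top]
  exact chainClass_surjective

theorem H1Map_hurewicz (f : N →* N) (n : N) : H1Map k f (hurewicz k n) = hurewicz k (f n) := by
  have h := groupHomology.H1π_comp_map_apply (A := Rep.trivial k N k) (B := Rep.trivial k N k) f
    (𝟙 (Rep.trivial k N k))
    ((groupHomology.cycles₁IsoOfIsTrivial (Rep.trivial k N k)).inv.hom (Finsupp.single n (1 : k)))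
  refine h.trans ?_
  refine congrArg (groupHomology.H1π (Rep.trivial k N k)).hom (Subtype.ext ?_)
  change Finsupp.mapRange.linearMap _ (Finsupp.mapDomain f (Finsupp.single n (1 : k))) =
    Finsupp.single (f n) (1 : k)
  rw [Finsupp.mapDomain_single]
  exact Finsupp.mapRange_single (hf := map_zero _)

/-- Universal property of `H₁(N, k)`: homomorphisms `N → k` extend to functionals. -/
theorem exists_comp_hurewicz (φ : Additive N →+ k) :
    ∃ ψ : H1 k N →ₗ[k] k, ∀ n, ψ (hurewicz k n) = φ (Additive.ofMul n) := by
  let Φ : (N →₀ k) →ₗ[k] k := Finsupp.linearCombination k fun n => φ (Additive.ofMul n)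
  have hΦ : LinearMap.ker (chainClass k N) ≤ LinearMap.ker Φ := by
    intro x hx
    obtain ⟨y, rfl⟩ := (chainClass_eq_zero_iff x).1 hx
    rw [LinearMap.mem_ker]
    refine LinearMap.congr_fun (f := Φ ∘ₗ (groupHomology.d₂₁ (Rep.trivial k N k)).hom) (g := 0) ?_ y
    refine Finsupp.lhom_ext fun ⟨a, b⟩ r => ?_
    refine (congrArg Φ (boundary_single a b r)).trans ?_
    simp [Φ, mul_add, ofMul_mul]
  refine ⟨(LinearMap.ker (chainClass k N)).liftQ Φ hΦ ∘ₗ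
    ((chainClass k N).quotKerEquivOfSurjective chainClass_surjective).symm.toLinearMap,
    fun n => ?_⟩
  have : ((chainClass k N).quotKerEquivOfSurjective chainClass_surjective).symm (hurewicz k n) =
      Submodule.Quotient.mk (Finsupp.single n 1) := by
    rw [LinearEquiv.symm_apply_eq]; rfl
  rw [LinearMap.comp_apply, LinearEquiv.coe_coe, this]
  simp [Φ]

end Homology

/-! ### The Aomoto complex in degree one -/

section Cohomology

variable {G : Type u} [Group G]

theorem aomotoBetti_one_eq_zero_iff (ν : G →* Multiplicative ℤ) :
    aomotoBetti k ν 1 = 0 ↔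
      ∀ x : Hcoh k G 1, cup (nuClass k ν) 1 x = 0 → ∃ y, cup (nuClass k ν) 0 y = x := by
  rw [aomotoBetti, rank_zero_iff,
    ← ModuleCat.isZero_iff_subsingleton, ← HomologicalComplex.exactAt_iff_isZero_homology,
    HomologicalComplex.exactAt_iff' _ 0 1 2 (by simp) (by simp),
    ShortComplex.moduleCat_exact_iff]
  have h0 : (aomotoComplex k ν).d 0 1 = cup (nuClass k ν) 0 :=
    CochainComplex.of_d (fun n => Hcoh k G n) (fun n => cup (nuClass k ν) n) 0
  have h1 : (aomotoComplex k ν).d 1 2 = cup (nuClass k ν) 1 :=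
    CochainComplex.of_d (fun n => Hcoh k G n) (fun n => cup (nuClass k ν) n) 1
  change (∀ x, (aomotoComplex k ν).d 1 2 x = 0 → ∃ y, (aomotoComplex k ν).d 0 1 y = x) ↔ _
  rw [h0, h1]
  rfl

theorem iCocycles_injective (n : ℕ) :
    Function.Injective (groupCohomology.iCocycles (Rep.trivial k G k) n) :=
  (ModuleCat.mono_iff_injective _).1 inferInstance

theorem exists_iCocycles_eq {n : ℕ} (f : (Fin n → G) → k)
    (hf : (inhomogeneousCochains.d (Rep.trivial k G k) n).hom f = 0) :
    ∃ x, groupCohomology.iCocycles (Rep.trivial k G k) n x = f :=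
  ⟨groupCohomology.cocyclesMk (A := Rep.trivial k G k) f hf,
    groupCohomology.iCocycles_mk (A := Rep.trivial k G k) f hf⟩

theorem iCocycles_cupCocycles (z : Additive G →+ k) (n : ℕ)
    (x : groupCohomology.cocycles (Rep.trivial k G k) n) :
    groupCohomology.iCocycles (Rep.trivial k G k) (n + 1) (cupCocycles z n x) =
      cupCochain (fun g => z (Additive.ofMul g)) n
        (groupCohomology.iCocycles (Rep.trivial k G k) n x) := by
  have : cupCocycles z n ≫ groupCohomology.iCocycles (Rep.trivial k G k) (n + 1) =
      groupCohomology.iCocycles (Rep.trivial k G k) n ≫ cupX (fun g => z (Additive.ofMul g)) n :=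
    HomologicalComplex.liftCycles_i _ _ _ _ _
  exact congr($this x)

theorem π_eq_zero_iff (n : ℕ) (x : groupCohomology.cocycles (Rep.trivial k G k) (n + 1)) :
    groupCohomology.π (Rep.trivial k G k) (n + 1) x = 0 ↔
      ∃ f : (Fin n → G) → k, (inhomogeneousCochains.d (Rep.trivial k G k) n).hom f =
        groupCohomology.iCocycles (Rep.trivial k G k) (n + 1) x := by
  let S : ShortComplex (ModuleCat k) := ShortComplex.mk _ _
    ((groupCohomology.inhomogeneousCochains (Rep.trivial k G k)).toCycles_comp_homologyπ n (n + 1))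
  have hS : S.Exact := S.exact_of_g_is_cokernel
    ((groupCohomology.inhomogeneousCochains (Rep.trivial k G k)).homologyIsCokernel n (n + 1)
      (CochainComplex.prev_nat_succ n))
  have hi (f : (Fin n → G) → k) :
      groupCohomology.iCocycles (Rep.trivial k G k) (n + 1)
          (groupCohomology.toCocycles (Rep.trivial k G k) n (n + 1) f) =
        (inhomogeneousCochains.d (Rep.trivial k G k) n).hom f := by
    have h := HomologicalComplex.toCycles_i
      (groupCohomology.inhomogeneousCochains (Rep.trivial k G k)) n (n + 1)
    rw [groupCohomology.inhomogeneousCochains.d_def] at h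
    exact congr($h f)
  constructor
  · intro hx
    obtain ⟨f, hf⟩ := (ShortComplex.moduleCat_exact_iff S).1 hS x hx
    exact ⟨f, by rw [← hi]; exact congrArg _ hf⟩
  · rintro ⟨f, hf⟩
    rw [← hi] at hf
    rw [← iCocycles_injective _ hf]
    exact congr($(S.zero) f)

theorem cup_π (z : Additive G →+ k) (n : ℕ)
    (x : groupCohomology.cocycles (Rep.trivial k G k) n) :
    cup z n (groupCohomology.π (Rep.trivial k G k) n x) =
      groupCohomology.π (Rep.trivial k G k) (n + 1) (cupCocycles z n x) :=
  congr($(π_cup z n) x)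

/-- In terms of cochains: `β₁ = 0` if and only if every homomorphism `f : G → k` for which
`ν_k ∪ f` is the coboundary of some `c` is a multiple of `ν_k`. -/
theorem aomotoBetti_one_eq_zero_iff_forall_hom (ν : G →* Multiplicative ℤ) :
    aomotoBetti k ν 1 = 0 ↔
      ∀ f : Additive G →+ k,
        (∃ c : G → k, ∀ x y, c x + c y - c (x * y) =
          ((ν x).toAdd : k) * f (Additive.ofMul y)) →
        ∃ a : k, ∀ x, f (Additive.ofMul x) = a * ((ν x).toAdd : k) := by
  have hd0 : ∀ f : (Fin 0 → G) → k, (inhomogeneousCochains.d (Rep.trivial k G k) 0).hom f = 0 := by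
    intro f
    ext g
    rw [d_trivial_apply]
    rw [Fin.sum_univ_one, Subsingleton.elim (Fin.contractNth 0 (· * ·) g) (fun i => g i.succ)]
    simp
    rfl
  have hd1 : ∀ (f : (Fin 1 → G) → k) (g : Fin 2 → G),
      (inhomogeneousCochains.d (Rep.trivial k G k) 1).hom f g =
        f (fun _ => g 0) + f (fun _ => g 1) - f (fun _ => g 0 * g 1) := by
    intro f g
    have h0 : (fun i : Fin 1 => g i.succ) = fun _ => g 1 := by ext i; fin_cases i; rfl
    have h1 : Fin.contractNth 0 (· * ·) g = fun _ => g 0 * g 1 := by ext i; fin_cases i; rfl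
    have h2 : Fin.contractNth 1 (· * ·) g = fun _ => g 0 := by ext i; fin_cases i; rfl
    rw [d_trivial_apply, Fin.sum_univ_two, h0, h1, h2]
    simp
    ring
  have hcup : ∀ (F : (Fin 1 → G) → k) (g : Fin 2 → G),
      cupCochain (fun x => nuClass k ν (Additive.ofMul x)) 1 F g =
        ((ν (g 0)).toAdd : k) * F (fun _ => g 1) := by
    intro F g
    have h0 : (fun i : Fin 1 => g i.succ) = fun _ => g 1 := by ext i; fin_cases i; rfl
    rw [← h0]
    rfl
  rw [aomotoBetti_one_eq_zero_iff]
  constructor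
  · rintro h f ⟨c, hc⟩
    let F : (Fin 1 → G) → k := fun g => f (Additive.ofMul (g 0))
    have hF : (inhomogeneousCochains.d (Rep.trivial k G k) 1).hom F = 0 := by
      ext g
      rw [hd1]
      simp [F, ofMul_mul]
      rfl
    obtain ⟨x, hiF⟩ := exists_iCocycles_eq F hF
    obtain ⟨y, hy⟩ := h (groupCohomology.π _ 1 x) (by
      rw [cup_π, π_eq_zero_iff, iCocycles_cupCocycles]
      refine ⟨fun g => c (g 0), ?_⟩
      rw [hiF]
      ext g
      rw [hd1, hcup]
      exact hc _ _)
    induction y using groupCohomology_induction_on with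
    | h y =>
    rw [cup_π, ← sub_eq_zero, ← map_sub, π_eq_zero_iff] at hy
    obtain ⟨f0, hf0⟩ := hy
    rw [hd0, map_sub, iCocycles_cupCocycles, hiF, eq_comm, sub_eq_zero] at hf0
    refine ⟨groupCohomology.iCocycles (Rep.trivial k G k) 0 y default, fun x => ?_⟩
    refine (congrFun hf0 (fun _ => x)).symm.trans ?_
    rw [mul_comm]
    change _ * groupCohomology.iCocycles (Rep.trivial k G k) 0 y _ = _
    rw [Subsingleton.elim default]
    rfl
  · intro h x hx
    induction x using groupCohomology_induction_on with
    | h x =>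
    rw [cup_π, π_eq_zero_iff, iCocycles_cupCocycles] at hx
    obtain ⟨c, hc⟩ := hx
    set F : (Fin 1 → G) → k := groupCohomology.iCocycles (Rep.trivial k G k) 1 x with hF
    have hdF : (inhomogeneousCochains.d (Rep.trivial k G k) 1).hom F = 0 := by
      have h := HomologicalComplex.iCycles_d
        (groupCohomology.inhomogeneousCochains (Rep.trivial k G k)) 1 2
      rw [groupCohomology.inhomogeneousCochains.d_def] at h
      exact congr($h x)
    obtain ⟨a, ha⟩ := h (AddMonoidHom.mk' (fun g => F fun _ => g.toMul) fun x y => by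
        have := congrFun hdF ![x.toMul, y.toMul]
        rw [hd1] at this
        exact (sub_eq_zero.1 this).symm)
      ⟨fun g => c fun _ => g, fun x y => by
        have := congrFun hc ![x, y]
        rw [hd1, hcup] at this
        exact this⟩
    obtain ⟨y, hy⟩ := exists_iCocycles_eq (fun _ => a) (hd0 _)
    refine ⟨groupCohomology.π _ 0 y, ?_⟩
    rw [cup_π]
    congr 1
    refine iCocycles_injective 1 ?_
    rw [iCocycles_cupCocycles]
    ext g
    have hg : g = fun _ => g 0 := by ext i; rw [Subsingleton.elim (α := Fin 1) i 0]
    rw [hg]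
    refine Eq.trans ?_ ((mul_comm _ _).trans (ha (g 0)).symm)
    rw [hy]
    rfl

end Cohomology

/-! ### Extensions by the integers -/

section Extension

variable {N G : Type u} [Group N] [Group G]

/-- The endomorphism `t - 1` of `H₁(N, k)`. -/
def monodromySubId (k : Type u) [Field k] (S : GroupExtension N G (Multiplicative ℤ)) (g : G) :
    Module.End k (H1 k N) :=
  conjRep k S g - 1

/-- By duality, `ker (T* ∘ T*) = ker T*` if and only if `T V = T² V`. -/
theorem forall_dual_comp_eq_zero_iff {V : Type*} [AddCommGroup V] [Module k V]
    (T : Module.End k V) :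
    (∀ ψ : Module.Dual k V, ψ ∘ₗ T ∘ₗ T = 0 → ψ ∘ₗ T = 0) ↔ ∀ v, ∃ w, T v = T (T w) := by
  constructor
  · intro h v
    by_contra! hv
    have hv' : T v ∉ LinearMap.range (T ∘ₗ T) := fun ⟨w, hw⟩ => hv w hw.symm
    obtain ⟨ψ, hψ, hle⟩ := Submodule.exists_le_ker_of_notMem hv'
    refine hψ (LinearMap.congr_fun (h ψ ?_) v)
    exact LinearMap.ext fun w => hle ⟨w, rfl⟩
  · intro h ψ hψ
    ext v
    obtain ⟨w, hw⟩ := h v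
    rw [LinearMap.comp_apply, hw]
    exact LinearMap.congr_fun hψ w

variable (S : GroupExtension N G (Multiplicative ℤ)) {g : G}

theorem conjRep_hurewicz (x : G) (n : N) :
    conjRep k S x (hurewicz k n) = hurewicz k (S.conjAct x n) :=
  H1Map_hurewicz _ n

theorem tSubOne_smul (m : H1 k N) :
    tSubOne k • (monodromy k S g).asModuleEquiv.symm m =
      (monodromy k S g).asModuleEquiv.symm (monodromySubId k S g m) := by
  rw [LinearEquiv.eq_symm_apply, Representation.asModuleEquiv_map_smul]
  rw [LinearEquiv.apply_symm_apply, tSubOne, map_sub,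
    map_one (Representation.asAlgebraHom _), Representation.asAlgebraHom_of]
  change conjRep k S (g ^ (1 : ℤ)) m - m = conjRep k S g m - m
  rw [zpow_one]

theorem smulImageStable_iff :
    SmulImageStable (tSubOne k) (monodromy k S g).asModule ↔
      ∀ v, ∃ w, monodromySubId k S g v = monodromySubId k S g (monodromySubId k S g w) := by
  refine ((monodromy k S g).asModuleEquiv.symm.toEquiv.forall_congr fun v =>
    (monodromy k S g).asModuleEquiv.symm.toEquiv.exists_congr fun w => ?_).symm
  change _ ↔ tSubOne k • (monodromy k S g).asModuleEquiv.symm v =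
    tSubOne k ^ 2 • (monodromy k S g).asModuleEquiv.symm w
  rw [pow_two, mul_smul, tSubOne_smul, tSubOne_smul, tSubOne_smul]
  exact (monodromy k S g).asModuleEquiv.symm.injective.eq_iff.symm

theorem exists_inl_mul_zpow (hg : S.rightHom g = Multiplicative.ofAdd 1) (x : G) :
    ∃ n, x = S.inl n * g ^ (S.rightHom x).toAdd := by
  have h : x * (g ^ (S.rightHom x).toAdd)⁻¹ ∈ S.inl.range := by
    rw [S.range_inl_eq_ker_rightHom, MonoidHom.mem_ker, map_mul, map_inv, map_zpow, hg,
      ← ofAdd_zsmul]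
    simp
  obtain ⟨n, hn⟩ := h
  exact ⟨n, by rw [hn, inv_mul_cancel_right]⟩

/-- The element `n` of `N` in the decomposition `x = n * g ^ ν x` of `x` in `G`. -/
def fiberPart (hg : S.rightHom g = Multiplicative.ofAdd 1) (x : G) : N :=
  (exists_inl_mul_zpow S hg x).choose

theorem inl_fiberPart_mul_zpow (hg : S.rightHom g = Multiplicative.ofAdd 1) (x : G) :
    S.inl (fiberPart S hg x) * g ^ (S.rightHom x).toAdd = x :=
  (exists_inl_mul_zpow S hg x).choose_spec.symm

theorem inl_fiberPart (hg : S.rightHom g = Multiplicative.ofAdd 1) (x : G) :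
    S.inl (fiberPart S hg x) = x * (g ^ (S.rightHom x).toAdd)⁻¹ :=
  eq_mul_inv_of_mul_eq (inl_fiberPart_mul_zpow S hg x)

theorem fiberPart_inl (hg : S.rightHom g = Multiplicative.ofAdd 1) (n : N) :
    fiberPart S hg (S.inl n) = n := by
  apply S.inl_injective
  rw [inl_fiberPart, S.rightHom_inl, toAdd_one, zpow_zero, inv_one, mul_one]

theorem fiberPart_mul (hg : S.rightHom g = Multiplicative.ofAdd 1) (x y : G) :
    fiberPart S hg (x * y) =
      fiberPart S hg x * S.conjAct (g ^ (S.rightHom x).toAdd) (fiberPart S hg y) := by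
  apply S.inl_injective
  rw [map_mul, S.inl_conjAct_comm, inl_fiberPart, inl_fiberPart, inl_fiberPart, map_mul,
    toAdd_mul, zpow_add, mul_inv_rev]
  group

theorem fiberPart_one (hg : S.rightHom g = Multiplicative.ofAdd 1) : fiberPart S hg 1 = 1 := by
  rw [← map_one S.inl, fiberPart_inl]

theorem fiberPart_inv (hg : S.rightHom g = Multiplicative.ofAdd 1) (x : G) :
    fiberPart S hg x⁻¹ = S.conjAct (g ^ (-(S.rightHom x).toAdd)) (fiberPart S hg x)⁻¹ := by
  have h := fiberPart_mul S hg x⁻¹ x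
  rw [inv_mul_cancel, fiberPart_one, map_inv, toAdd_inv] at h
  rw [map_inv]
  exact eq_inv_of_mul_eq_one_left h.symm

/-- If `G` is finitely generated, then finitely many elements of `N` together with their conjugates
by the powers of `g` generate `N`: the elements `fiberPart S hg x` do, for `x` in a finite
generating set of `G`. -/
theorem exists_finite_forall_subgroup_eq_top [Group.FG G]
    (hg : S.rightHom g = Multiplicative.ofAdd 1) :
    ∃ s : Set N, s.Finite ∧ ∀ K : Subgroup N, s ⊆ K →
      (∀ a : ℤ, ∀ n ∈ K, S.conjAct (g ^ a) n ∈ K) → K = ⊤ := by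
  obtain ⟨t, ht, htf⟩ := Group.fg_iff.1 ‹Group.FG G›
  refine ⟨fiberPart S hg '' t, htf.image _, fun K hK h => ?_⟩
  have key : ∀ x, fiberPart S hg x ∈ K := by
    intro x
    have hx : x ∈ Subgroup.closure t := ht ▸ Subgroup.mem_top x
    induction hx using Subgroup.closure_induction with
    | mem x hx => exact hK ⟨x, hx, rfl⟩
    | one => rw [fiberPart_one]; exact K.one_mem
    | mul x y _ _ hx hy => rw [fiberPart_mul]; exact K.mul_mem hx (h _ _ hy)
    | inv x _ hx => rw [fiberPart_inv]; exact h _ _ (K.inv_mem hx)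
  exact (Subgroup.eq_top_iff' K).2 fun n => fiberPart_inl S hg n ▸ key (S.inl n)

theorem of_smul_hurewicz (a : ℤ) (n : N) :
    MonoidAlgebra.of k _ (Multiplicative.ofAdd a) •
        (monodromy k S g).asModuleEquiv.symm (hurewicz k n) =
      (monodromy k S g).asModuleEquiv.symm (hurewicz k (S.conjAct (g ^ a) n)) := by
  rw [← Representation.asModuleEquiv_symm_map_rho, ← conjRep_hurewicz]
  rfl

theorem finite_monodromy_asModule [Group.FG G] (hg : S.rightHom g = Multiplicative.ofAdd 1) :
    Module.Finite (MonoidAlgebra k (Multiplicative ℤ)) (monodromy k S g).asModule := by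
  obtain ⟨s, hs, h⟩ := exists_finite_forall_subgroup_eq_top S hg
  let c : N → (monodromy k S g).asModule :=
    fun n => (monodromy k S g).asModuleEquiv.symm (hurewicz k n)
  have hc : ∀ a b, c (a * b) = c a + c b := fun a b => by
    simp only [c, hurewicz_mul, map_add]
  let C : N →* Multiplicative (monodromy k S g).asModule :=
    MonoidHom.mk' (fun n => Multiplicative.ofAdd (c n)) fun a b => by rw [hc, ofAdd_add]
  let W := Submodule.span (MonoidAlgebra k (Multiplicative ℤ)) (c '' s)
  have hK := h (W.toAddSubgroup.toSubgroup.comap C)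
    (fun n hn => Submodule.subset_span ⟨n, hn, rfl⟩) fun a n hn => by
      have := W.smul_mem (MonoidAlgebra.of k _ (Multiplicative.ofAdd a)) hn
      exact (congrArg (· ∈ W) (of_smul_hurewicz (k := k) S a n)).mp this
  refine ⟨Submodule.fg_def.2 ⟨c '' s, hs.image c, ?_⟩⟩
  have hW : ∀ n, c n ∈ W := fun n =>
    ((Subgroup.eq_top_iff' _).1 hK n : n ∈ W.toAddSubgroup.toSubgroup.comap C)
  have htop : (W.restrictScalars k).map (monodromy k S g).asModuleEquiv.toLinearMap = ⊤ := by
    rw [eq_top_iff, ← span_range_hurewicz, Submodule.span_le]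
    rintro _ ⟨n, rfl⟩
    exact ⟨c n, hW n, (monodromy k S g).asModuleEquiv.apply_symm_apply _⟩
  refine (Submodule.eq_top_iff' (p := W)).2 fun m => ?_
  obtain ⟨m', hm', h'⟩ := (Submodule.eq_top_iff'.1 htop) ((monodromy k S g).asModuleEquiv m)
  exact (monodromy k S g).asModuleEquiv.injective h' ▸ hm'

/-- If `ψ ∘ (t - 1)² = 0`, then `ψ ∘ (t - 1)` is invariant under `t`, and `ψ ∘ t ^ a` is an affine
function of `a`. -/
theorem dual_conjRep_zpow (ψ : Module.Dual k (H1 k N))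
    (hψ : ψ ∘ₗ monodromySubId k S g ∘ₗ monodromySubId k S g = 0) (v : H1 k N) (a : ℤ) :
    ψ (monodromySubId k S g (conjRep k S (g ^ a) v)) = ψ (monodromySubId k S g v) ∧
      ψ (conjRep k S (g ^ a) v) = ψ v + a * ψ (monodromySubId k S g v) := by
  have h1 (w : H1 k N) : ψ (conjRep k S g w) = ψ w + ψ (monodromySubId k S g w) := by
    simp [monodromySubId]
  have h2 (w : H1 k N) : ψ (monodromySubId k S g (conjRep k S g w)) =
      ψ (monodromySubId k S g w) := by
    have := LinearMap.congr_fun hψ w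
    rw [LinearMap.comp_apply, LinearMap.comp_apply] at this
    nth_rw 2 [monodromySubId] at this
    rw [LinearMap.sub_apply, map_sub, map_sub] at this
    exact sub_eq_zero.1 this
  have hs (a : ℤ) : conjRep k S (g ^ (a + 1)) v = conjRep k S g (conjRep k S (g ^ a) v) := by
    rw [add_comm, zpow_add, zpow_one, map_mul]
    rfl
  induction a using Int.induction_on with
  | zero => simp
  | succ a ih =>
    rw [hs, h1, h2, ih.1, ih.2]
    refine ⟨rfl, ?_⟩
    push_cast
    ring
  | pred a ih =>
    have h := hs (-(a : ℤ) - 1)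
    rw [sub_add_cancel] at h
    rw [h, h1, h2] at ih
    refine ⟨ih.1, ?_⟩
    rw [eq_sub_of_add_eq ih.2, ih.1]
    push_cast
    ring

theorem monodromySubId_hurewicz (n : N) :
    monodromySubId k S g (hurewicz k n) = hurewicz k (S.conjAct g n) - hurewicz k n := by
  rw [← conjRep_hurewicz]
  rfl

theorem dual_ext {ψ χ : Module.Dual k (H1 k N)} (h : ∀ n, ψ (hurewicz k n) = χ (hurewicz k n)) :
    ψ = χ :=
  LinearMap.ext_on_range span_range_hurewicz h

/-- In terms of functionals on `H₁(N, k)`: for `ψ` with `ψ ∘ (t - 1)² = 0`, the cochains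
`f x = ψ ((t - 1) [n])` and `c x = -ψ [n]`, where `x = n * g ^ ν x`, are a homomorphism and a
solution of `d c = ν_k ∪ f`; conversely `c` restricts to a functional. -/
theorem aomotoBetti_one_eq_zero_iff_forall_dual (hg : S.rightHom g = Multiplicative.ofAdd 1) :
    aomotoBetti k S.rightHom 1 = 0 ↔ ∀ ψ : Module.Dual k (H1 k N),
      ψ ∘ₗ monodromySubId k S g ∘ₗ monodromySubId k S g = 0 → ψ ∘ₗ monodromySubId k S g = 0 := by
  rw [aomotoBetti_one_eq_zero_iff_forall_hom]
  constructor
  · intro h ψ hψ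
    have hz := dual_conjRep_zpow S ψ hψ
    have hp (x y : G) : hurewicz k (fiberPart S hg (x * y)) = hurewicz k (fiberPart S hg x) +
        conjRep k S (g ^ (S.rightHom x).toAdd) (hurewicz k (fiberPart S hg y)) := by
      rw [fiberPart_mul, hurewicz_mul, conjRep_hurewicz]
    obtain ⟨a, ha⟩ := h
      (AddMonoidHom.mk' (fun x => ψ (monodromySubId k S g (hurewicz k (fiberPart S hg x.toMul))))
        fun x y => by rw [toMul_add, hp, map_add, map_add, (hz _ _).1])
      ⟨fun x => -ψ (hurewicz k (fiberPart S hg x)), fun x y => by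
        simp only [AddMonoidHom.mk'_apply, toMul_ofMul]
        rw [hp, map_add, (hz _ _).2]
        ring⟩
    refine dual_ext fun n => ?_
    have := ha (S.inl n)
    simpa [fiberPart_inl] using this
  · rintro h f ⟨c, hc⟩
    obtain ⟨ψ, hψ⟩ := exists_comp_hurewicz
      (AddMonoidHom.mk' (fun n : Additive N => c (S.inl n.toMul)) fun x y => by
        have := hc (S.inl x.toMul) (S.inl y.toMul)
        rw [S.rightHom_inl, toAdd_one, Int.cast_zero, zero_mul, ← map_mul] at this
        exact (sub_eq_zero.1 this).symm)
    replace hψ (n : N) : ψ (hurewicz k n) = c (S.inl n) := hψ n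
    have hT (n : N) : ψ (monodromySubId k S g (hurewicz k n)) = -f (Additive.ofMul (S.inl n)) := by
      -- Compare the two ways of writing `g * n = (g * n * g⁻¹) * g`.
      have h1 := hc g (S.inl n)
      have h2 := hc (S.inl (S.conjAct g n)) g
      rw [S.rightHom_inl, S.inl_conjAct_comm, inv_mul_cancel_right] at h2
      rw [hg] at h1
      simp only [toAdd_ofAdd, toAdd_one, Int.cast_one, Int.cast_zero, one_mul, zero_mul] at h1 h2
      rw [monodromySubId_hurewicz, map_sub, hψ, hψ, S.inl_conjAct_comm]
      linear_combination h2 - h1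
    have h0 := h ψ (dual_ext fun n => by
      rw [LinearMap.comp_apply, LinearMap.comp_apply]
      rw [monodromySubId_hurewicz, map_sub, map_sub, hT, hT, S.inl_conjAct_comm]
      simp [ofMul_mul])
    refine ⟨f (Additive.ofMul g), fun x => ?_⟩
    have hx := congrArg (fun y => f (Additive.ofMul y)) (inl_fiberPart_mul_zpow S hg x)
    have hn : f (Additive.ofMul (S.inl (fiberPart S hg x))) = 0 := by
      rw [← neg_eq_zero, ← hT]
      exact LinearMap.congr_fun h0 _
    rw [← hx]
    simp [ofMul_mul, ofMul_zpow, hn, mul_comm]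

end Extension

end CyclicExtension

end

theorem corollary2p2 {k N G : Type u} [Field k] [Group N] [Group G]
    (S : GroupExtension N G (Multiplicative ℤ)) (hG : Group.IsFinitelyPresented G)
    (g : G) (hg : S.rightHom g = Multiplicative.ofAdd 1) :
    (Module.Finite k (CyclicExtension.H1 k N) ∧
      ∀ i : ℕ, 1 < i → ¬ CyclicExtension.HasJordanBlock (CyclicExtension.tSubOne k) i
        (CyclicExtension.monodromy k S g).asModule) ↔
    CyclicExtension.aomotoBetti k S.rightHom 1 = 0 := by
  have hfg : Group.FG G := by
    obtain ⟨n, φ, hφ, -⟩ := hG.out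
    exact Group.fg_of_surjective hφ
  have := CyclicExtension.finite_monodromy_asModule (k := k) S hg
  rw [CyclicExtension.aomotoBetti_one_eq_zero_iff_forall_dual S hg,
    CyclicExtension.forall_dual_comp_eq_zero_iff,
    ← CyclicExtension.smulImageStable_iff]
  exact CyclicExtension.finite_and_not_hasJordanBlock_iff (k := k)
    (CyclicExtension.monodromy k S g).asModule
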